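/- An instance of the Frequency-Constrained Maintenance Jobs problem (FCMJ) consists of a finite rooted tree whose leaves form the set $\mathcal C$ of components and whose inner nodes form the set $\mathcal M$ of modules, setup costs $K_v\in\mathbb Q_{\ge 0}$ for $v\in\mathcal C\cup\mathcal M$, and cycle limits $f_c$ (natural numbers) for $c\in\mathcal C$. With $C_m\subseteq\mathcal C$ the set of components that are children of $m\in\mathcal M$, the problem is $$\min\ \sum_{c\in\mathcal C}\frac{K_c}{q_c}+\sum_{m\in\mathcal M}K_m\sum_{\emptyset\ne C\subseteq C_m}\frac{(-1)^{|C|+1}}{\operatorname{lcm}(q_c:c\in C)}\quad\text{subject to}\quad q_c\in\mathbb Z,\ 1\le q_c\le f_c\ \ (c\in\mathcal C).$$ An optimization problem $\Pi$ is called integer-factorization hard if there is an algorithm with access to an oracle, together with a polynomial $p$, such that for every oracle that answers each instance of $\Pi$ possessing an optimal solution with an optimal solution, the algorithm computes, for every composite number $M$, the prime factorization of $M$ in time at most $p(\text{number of bits of }M)$, each oracle call being counted as one unit of time. Here algorithms are programs of a random access machine on natural numbers (addition, truncated subtraction, multiplication, division with rounding down, indirect addressing) with logarithmic costs, i.e.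 each step costs one unit plus the bit lengths of the numbers it handles. Theorem. FCMJ is integer-factorization hard. It remains so when restricted to the instances whose tree consists of one module containing exactly two components, that is, to the instances of the form $$\min\ \frac{K_0+K_1}{q_1}+\frac{K_0+K_2}{q_2}-\frac{K_0}{\operatorname{lcm}(q_1,q_2)}\quad\text{subject to}\quad q_i\in\mathbb Z,\ 1\le q_i\le f_i\ \ (i=1,2).$$ -/

import Mathlib

/-! ### A random access machine with logarithmic costs and an oracle

The machine has countably many registers holding natural numbers, an output tape, a query tape on
which oracle queries are prepared, and a reply tape from which oracle answers are read. -/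

/-- A configuration of the machine. -/
structure MachineState where
  /-- contents of the registers -/
  mem : ℕ → ℕ
  /-- the numbers written on the output tape so far -/
  out : List ℕ
  /-- the oracle query under preparation -/
  query : List ℕ
  /-- the part of the last oracle answer that has not been read yet -/
  reply : List ℕ

namespace MachineState

/-- Initial configuration on input `M`: `M` is in register `0`, everything else is empty. -/
def init (M : ℕ) : MachineState where
  mem := Function.update (fun _ => 0) 0 M
  out := []
  query := []
  reply := []

/-- Put the number `x` into register `i`. -/
def set (s : MachineState) (i x : ℕ) : MachineState :=
  { s with mem := Function.update s.mem i x }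

end MachineState

/-- Elementary instructions. The letters `i j k` are register numbers, fixed in the program. -/
inductive Instr where
  /-- register `i` := the constant `n` -/
  | const (i n : ℕ)
  /-- register `i` := register `j` -/
  | copy (i j : ℕ)
  /-- register `i` := register `j` + register `k` -/
  | add (i j k : ℕ)
  /-- register `i` := register `j` - register `k`, truncated at `0` -/
  | sub (i j k : ℕ)
  /-- register `i` := register `j` * register `k` -/
  | mul (i j k : ℕ)
  /-- register `i` := register `j` / register `k`, rounded down -/
  | div (i j k : ℕ)
  /-- indirect read: register `i` := the register whose number is in register `j` -/
  | load (i j : ℕ)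
  /-- indirect write: the register whose number is in register `i` := register `j` -/
  | store (i j : ℕ)
  /-- append register `i` to the output tape -/
  | write (i : ℕ)
  /-- append register `i` to the query tape -/
  | ask (i : ℕ)
  /-- call the oracle: the answer to the query replaces the reply tape, the query tape is
  emptied -/
  | call
  /-- read the next number of the reply tape into register `i` (`0` if nothing is left) -/
  | receive (i : ℕ)

namespace Instr

/-- Logarithmic cost: one unit plus the bit lengths of the numbers (and of the computed addresses)
that the instruction handles. An oracle call costs one unit. -/
def cost (s : MachineState) : Instr → ℕ
  | const _ n => 1 + n.size
  | copy _ j => 1 + (s.mem j).size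
  | add _ j k => 1 + (s.mem j).size + (s.mem k).size
  | sub _ j k => 1 + (s.mem j).size + (s.mem k).size
  | mul _ j k => 1 + (s.mem j).size + (s.mem k).size
  | div _ j k => 1 + (s.mem j).size + (s.mem k).size
  | load _ j => 1 + (s.mem j).size + (s.mem (s.mem j)).size
  | store i j => 1 + (s.mem i).size + (s.mem j).size
  | write i => 1 + (s.mem i).size
  | ask i => 1 + (s.mem i).size
  | call => 1
  | receive _ => 1 + (s.reply.headD 0).size

/-- Effect of an instruction on a configuration, with oracle `O`. -/
def apply (O : List ℕ → List ℕ) (s : MachineState) : Instr → MachineState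
  | const i n => s.set i n
  | copy i j => s.set i (s.mem j)
  | add i j k => s.set i (s.mem j + s.mem k)
  | sub i j k => s.set i (s.mem j - s.mem k)
  | mul i j k => s.set i (s.mem j * s.mem k)
  | div i j k => s.set i (s.mem j / s.mem k)
  | load i j => s.set i (s.mem (s.mem j))
  | store i j => s.set (s.mem i) (s.mem j)
  | write i => { s with out := s.out ++ [s.mem i] }
  | ask i => { s with query := s.query ++ [s.mem i] }
  | call => { s with query := [], reply := O s.query }
  | receive i => { s.set i (s.reply.headD 0) with reply := s.reply.tail }

end Instr

/-- Programs, with structured control flow. -/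
inductive Prog where
  /-- a single instruction -/
  | instr (a : Instr)
  /-- sequential composition -/
  | seq (P Q : Prog)
  /-- run `P` if register `i` is nonzero, otherwise run `Q` -/
  | cond (i : ℕ) (P Q : Prog)
  /-- run `P` repeatedly as long as register `i` is nonzero -/
  | loop (i : ℕ) (P : Prog)

/-- `Runs O P s t s'`: with oracle `O`, the program `P` started in configuration `s` halts in
configuration `s'`, at total cost `t`. A test of register `i` costs one unit plus the bit length
of its content. -/
inductive Runs (O : List ℕ → List ℕ) : Prog → MachineState → ℕ → MachineState → Prop where
  | instr (a : Instr) (s : MachineState) :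
      Runs O (Prog.instr a) s (a.cost s) (a.apply O s)
  | seq {P Q : Prog} {s s₁ s₂ : MachineState} {t₁ t₂ : ℕ} :
      Runs O P s t₁ s₁ → Runs O Q s₁ t₂ s₂ → Runs O (Prog.seq P Q) s (t₁ + t₂) s₂
  | cond_pos {i : ℕ} {P Q : Prog} {s s₁ : MachineState} {t : ℕ} :
      s.mem i ≠ 0 → Runs O P s t s₁ →
      Runs O (Prog.cond i P Q) s (1 + (s.mem i).size + t) s₁
  | cond_zero {i : ℕ} {P Q : Prog} {s s₁ : MachineState} {t : ℕ} :
      s.mem i = 0 → Runs O Q s t s₁ →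
      Runs O (Prog.cond i P Q) s (1 + (s.mem i).size + t) s₁
  | loop_done {i : ℕ} {P : Prog} {s : MachineState} :
      s.mem i = 0 → Runs O (Prog.loop i P) s (1 + (s.mem i).size) s
  | loop_step {i : ℕ} {P : Prog} {s s₁ s₂ : MachineState} {t₁ t₂ : ℕ} :
      s.mem i ≠ 0 → Runs O P s t₁ s₁ → Runs O (Prog.loop i P) s₁ t₂ s₂ →
      Runs O (Prog.loop i P) s (1 + (s.mem i).size + t₁ + t₂) s₂

/-! ### Optimization problems and integer-factorization hardness -/

/-- A minimization problem whose instances and solutions are encoded by finite sequences of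
natural numbers. -/
structure OptProblem where
  /-- the instances -/
  Inst : Type
  /-- the candidate solutions of an instance -/
  Sol : Inst → Type
  /-- the constraints -/
  Feasible : (I : Inst) → Sol I → Prop
  /-- the objective function -/
  objective : (I : Inst) → Sol I → ℚ
  /-- encoding of instances -/
  encode : Inst → List ℕ
  /-- different instances have different encodings -/
  encode_injective : Function.Injective encode
  /-- encoding of solutions -/
  encodeSol : (I : Inst) → Sol I → List ℕ

namespace OptProblem

/-- `x` is an optimal solution of the instance `I`. -/
def IsOptimal (Pi : OptProblem) (I : Pi.Inst) (x : Pi.Sol I) : Prop :=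
  Pi.Feasible I x ∧ ∀ y : Pi.Sol I, Pi.Feasible I y → Pi.objective I x ≤ Pi.objective I y

/-- `O` is an exact solver of the problem: it answers every instance that has an optimal solution
with an optimal solution. Nothing is required of its other answers. -/
def SolvedBy (Pi : OptProblem) (O : List ℕ → List ℕ) : Prop :=
  ∀ I : Pi.Inst, (∃ x, Pi.IsOptimal I x) →
    ∃ x, Pi.IsOptimal I x ∧ O (Pi.encode I) = Pi.encodeSol I x

/-- The same problem on the instances with property `S` only. -/
def restrict (Pi : OptProblem) (S : Pi.Inst → Prop) : OptProblem where
  Inst := {I : Pi.Inst // S I}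
  Sol := fun I => Pi.Sol I.1
  Feasible := fun I => Pi.Feasible I.1
  objective := fun I => Pi.objective I.1
  encode := fun I => Pi.encode I.1
  encode_injective := Pi.encode_injective.comp Subtype.val_injective
  encodeSol := fun I => Pi.encodeSol I.1

/-- An optimization problem is integer-factorization hard if some oracle program computes the prime
factorization of every composite number `M` in time polynomial in the bit length of `M`, whatever
exact solver of the problem is used as the oracle, where an oracle call costs one unit. -/
def IntegerFactorizationHard (Pi : OptProblem) : Prop :=
  ∃ (P : Prog) (p : Polynomial ℕ), ∀ O : List ℕ → List ℕ, Pi.SolvedBy O →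
    ∀ M : ℕ, 1 < M → ¬ M.Prime →
      ∃ (t : ℕ) (s : MachineState), Runs O P (MachineState.init M) t s ∧
        t ≤ p.eval M.size ∧ (∀ r ∈ s.out, r.Prime) ∧ s.out.prod = M

end OptProblem

/-! ### The problem FCMJ -/

/-- An instance of the Frequency-Constrained Maintenance Jobs problem: a rooted tree whose inner
nodes are the modules and whose leaves are the components, with setup costs and cycle limits. -/
structure FCMJInstance where
  /-- the number of modules -/
  numModules : ℕ
  /-- the number of components -/
  numComponents : ℕ
  /-- the module that directly contains a given module (`none` for the root) -/
  parent : Fin numModules → Option (Fin numModules)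
  /-- the module that directly contains a given component -/
  home : Fin numComponents → Fin numModules
  /-- setup costs of the modules -/
  moduleCost : Fin numModules → NNRat
  /-- setup costs of the components -/
  componentCost : Fin numComponents → NNRat
  /-- cycle limits of the components -/
  limit : Fin numComponents → ℕ
  /-- there is a root, from which every module is reached by going from modules to their
  children -/
  rooted : ∃ r, parent r = none ∧
    ∀ m, Relation.ReflTransGen (fun a b => parent b = some a) r m
  /-- no module is a leaf -/
  not_leaf : ∀ m, (∃ m', parent m' = some m) ∨ ∃ c, home c = m

namespace FCMJInstance

/-- The components that are children of the module `m`. -/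
def children (I : FCMJInstance) (m : Fin I.numModules) : Finset (Fin I.numComponents) :=
  Finset.univ.filter (fun c => I.home c = m)

/-- Cycle times are positive integers that respect the cycle limits. -/
def Feasible (I : FCMJInstance) (q : Fin I.numComponents → ℕ) : Prop :=
  ∀ c, 1 ≤ q c ∧ q c ≤ I.limit c

/-- The cost rate of all components and modules. -/
def costRate (I : FCMJInstance) (q : Fin I.numComponents → ℕ) : ℚ :=
  ∑ c, (I.componentCost c : ℚ) / (q c : ℚ) +
    ∑ m, (I.moduleCost m : ℚ) *
      ∑ C ∈ (I.children m).powerset.filter (fun C => C.Nonempty),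
        (-1 : ℚ) ^ (C.card + 1) / ((C.lcm q : ℕ) : ℚ)

/-- The encoding of an instance: the number of modules, the number of components, the parents of
the modules (`0` for none, `p + 1` for the module `p`), numerators and denominators of the setup
costs of the modules, the modules containing the components, numerators and denominators of the
setup costs of the components, and the cycle limits. -/
def encode (I : FCMJInstance) : List ℕ :=
  [I.numModules, I.numComponents] ++
    (List.ofFn (fun m => (I.parent m).elim 0 (fun p => (p : ℕ) + 1)) ++
    (List.ofFn (fun m => (I.moduleCost m).num) ++
    (List.ofFn (fun m => (I.moduleCost m).den) ++
    (List.ofFn (fun c => (I.home c : ℕ)) ++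
    (List.ofFn (fun c => (I.componentCost c).num) ++
    (List.ofFn (fun c => (I.componentCost c).den) ++
    List.ofFn I.limit))))))

theorem encode_injective : Function.Injective encode := by
  rintro ⟨m, n, par, home, mc, cc, lim, h1, h2⟩ ⟨m', n', par', home', mc', cc', lim', h1', h2'⟩ h
  simp only [encode, List.cons_append, List.nil_append, List.cons.injEq] at h
  obtain ⟨rfl, rfl, h⟩ := h
  obtain ⟨e1, h⟩ := List.append_inj h (by simp)
  obtain ⟨e2, h⟩ := List.append_inj h (by simp)
  obtain ⟨e3, h⟩ := List.append_inj h (by simp)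
  obtain ⟨e4, h⟩ := List.append_inj h (by simp)
  obtain ⟨e5, h⟩ := List.append_inj h (by simp)
  obtain ⟨e6, e7⟩ := List.append_inj h (by simp)
  have e1 := List.ofFn_injective e1
  have e2 := List.ofFn_injective e2
  have e3 := List.ofFn_injective e3
  have e4 := List.ofFn_injective e4
  have e5 := List.ofFn_injective e5
  have e6 := List.ofFn_injective e6
  have e7 := List.ofFn_injective e7
  have a1 : par = par' := by
    funext i
    have := congrFun e1 i
    rcases hp : par i with _ | p <;> rcases hp' : par' i with _ | p' <;> simp_all [Fin.ext_iff]
  have a2 : home = home' := by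
    funext i
    exact Fin.ext (congrFun e4 i)
  have a3 : mc = mc' := by
    funext i
    exact NNRat.ext_num_den (congrFun e2 i) (congrFun e3 i)
  have a4 : cc = cc' := by
    funext i
    exact NNRat.ext_num_den (congrFun e5 i) (congrFun e6 i)
  subst a1 a2 a3 a4 e7
  rfl

/-- The hierarchies that consist of one module containing exactly two components. -/
def IsSimple (I : FCMJInstance) : Prop :=
  I.numModules = 1 ∧ I.numComponents = 2

end FCMJInstance

/-- The Frequency-Constrained Maintenance Jobs problem. -/
def FCMJ : OptProblem where
  Inst := FCMJInstance
  Sol := fun I => Fin I.numComponents → ℕ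
  Feasible := FCMJInstance.Feasible
  objective := FCMJInstance.costRate
  encode := FCMJInstance.encode
  encode_injective := FCMJInstance.encode_injective
  encodeSol := fun _ q => List.ofFn q

/-!
One oracle call finds a nontrivial divisor of a given number `x > 2` or shows that there is none.
Take a module of cost `1` with two components, the first one of cost `2 * x ^ 2` and limit `x`, the
second one of cost `0` and limit `x - 2`. The large cost forces `q 0 = x`
(`eq_of_isOptimal_divisorInstance`). What remains to be minimized is
`1 / q 1 - 1 / lcm x (q 1) = (x - gcd x (q 1)) / (x * q 1)`. With `q 1 = x - r` we have
`gcd x (q 1) = gcd x r ≤ r`, so this is at least `1 / x`, with equality if and only if `r ∣ x`.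
Since `2 ≤ r < x`, a composite `x` allows equality, and then every optimal solution yields a
nontrivial divisor `r = x - q 1` (`sub_dvd_of_isOptimal_divisorInstance`). If the `r` computed from
the oracle's answer does not divide `x`, then `x` is prime. In particular, no separate primality test
is needed.

The program keeps a cofactor `N` of `M` and a divisor `x` of `N`. It replaces `x` by the divisors
found by the oracle until `x` is prime, writes `x`, divides `N` by `x` and starts again with `x = N`,
until `N = 1`. There are `O(log M)` primes, each reached after `O(log M)` oracle calls, and each round
has cost `O(log M)`, which gives a cubic bound (`Factorization.runs_program`). The instances asked
all consist of one module with two components, and a solver of FCMJ solves those in particular.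
-/

/-! ### The instance attached to a number -/

namespace FCMJInstance

/-- The instance attached to a number `x`: one module of cost `1` with two components whose cycle
limits are `x` and `x - 2`. The cost `2 * x ^ 2` of the first component is so large that every
optimal solution has `q 0 = x`; the second component is free. -/
def divisorInstance (x : ℕ) : FCMJInstance where
  numModules := 1
  numComponents := 2
  parent := fun _ => none
  home := fun _ => 0
  moduleCost := fun _ => 1
  componentCost := ![((x * x + x * x : ℕ) : NNRat), 0]
  limit := ![x, x - 2]
  rooted := ⟨0, rfl, fun m => by rw [Subsingleton.elim m 0]⟩
  not_leaf := fun m => Or.inr ⟨0, Subsingleton.elim _ _⟩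

theorem isSimple_divisorInstance (x : ℕ) : (divisorInstance x).IsSimple := ⟨rfl, rfl⟩

theorem encode_divisorInstance (x : ℕ) :
    (divisorInstance x).encode = [1, 2, 0, 1, 1, 0, 0, x * x + x * x, 0, 1, 1, x, x - 2] := by
  have h1 : ((x : NNRat) * x + x * x).num = x * x + x * x := by
    exact_mod_cast NNRat.num_natCast (x * x + x * x)
  have h2 : ((x : NNRat) * x + x * x).den = 1 := by
    exact_mod_cast NNRat.den_natCast (x * x + x * x)
  simp [encode, divisorInstance, List.ofFn_succ, h1, h2]

theorem costRate_divisorInstance (x : ℕ) (q : Fin 2 → ℕ) :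
    (divisorInstance x).costRate q =
      (2 * x ^ 2 : ℚ) / q 0 + (1 / q 0 + 1 / q 1 - 1 / (Nat.lcm (q 0) (q 1) : ℕ)) := by
  have hp : ∀ m : Fin 1, ((Finset.univ.filter fun _ : Fin 2 => (0 : Fin 1) = m).powerset.filter
      fun C => C.Nonempty) = {{0}, {1}, {0, 1}} := by decide
  have h01 : ({0, 1} : Finset (Fin 2)).card = 2 := by decide
  have e : (divisorInstance x).costRate q =
      ∑ c : Fin 2, (((![((x * x + x * x : ℕ) : NNRat), 0] : Fin 2 → NNRat) c : NNRat) : ℚ) / q c +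
      ∑ m : Fin 1, ((1 : NNRat) : ℚ) *
      ∑ C ∈ (Finset.univ.filter fun _ : Fin 2 => (0 : Fin 1) = m).powerset.filter
        (fun C => C.Nonempty), (-1 : ℚ) ^ (C.card + 1) / ((C.lcm q : ℕ) : ℚ) := rfl
  rw [e, Fin.sum_univ_two, Fin.sum_univ_one, hp, Finset.sum_insert (by decide),
    Finset.sum_insert (by decide), Finset.sum_singleton, h01]
  simp [Finset.lcm_insert, lcm_eq_nat_lcm]
  ring

theorem feasible_divisorInstance {x : ℕ} {q : Fin 2 → ℕ} :
    (divisorInstance x).Feasible q ↔ (1 ≤ q 0 ∧ q 0 ≤ x) ∧ (1 ≤ q 1 ∧ q 1 ≤ x - 2) := by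
  have e : (divisorInstance x).Feasible q ↔
      ∀ c : Fin 2, 1 ≤ q c ∧ q c ≤ (![x, x - 2] : Fin 2 → ℕ) c := Iff.rfl
  rw [e, Fin.forall_fin_two]
  simp

/-- An instance with a feasible solution has an optimal one, since there are only finitely many
feasible solutions. -/
theorem exists_isOptimal {I : FCMJInstance} {q : Fin I.numComponents → ℕ} (hq : I.Feasible q) :
    ∃ q, FCMJ.IsOptimal I q := by
  have key : ∀ q, q ∈ Fintype.piFinset (fun c => Finset.Icc 1 (I.limit c)) ↔ I.Feasible q := by
    intro q
    simp [Feasible, Fintype.mem_piFinset]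
  obtain ⟨q', h, hmin⟩ := Finset.exists_min_image _ I.costRate ⟨q, (key q).2 hq⟩
  exact ⟨q', (key q').1 h, fun y hy => hmin y ((key y).2 hy)⟩

/-- Bounds for the module part of the objective, which the cost of the first component has to
outweigh. -/
theorem one_div_add_sub_lcm_mem {a b : ℕ} (ha : 1 ≤ a) (hb : 1 ≤ b) :
    0 ≤ (1 / a + 1 / b - 1 / (Nat.lcm a b : ℕ) : ℚ) ∧
      (1 / a + 1 / b - 1 / (Nat.lcm a b : ℕ) : ℚ) ≤ 2 := by
  have h1 : (1 / (a : ℚ)) ≤ 1 := by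
    rw [div_le_one (by positivity)]; exact_mod_cast ha
  have h2 : (1 / (b : ℚ)) ≤ 1 := by
    rw [div_le_one (by positivity)]; exact_mod_cast hb
  have h3 : (1 / ((Nat.lcm a b : ℕ) : ℚ)) ≤ 1 / a := by
    apply one_div_le_one_div_of_le (by positivity)
    exact_mod_cast Nat.le_of_dvd (Nat.lcm_pos ha hb) (Nat.dvd_lcm_left a b)
  have h4 : 0 ≤ (1 / ((Nat.lcm a b : ℕ) : ℚ)) := by positivity
  have h5 : 0 ≤ (1 / (b : ℚ)) := by positivity
  constructor <;> linarith

/-- The large cost of the first component forces its cycle time to the limit. -/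
theorem eq_of_isOptimal_divisorInstance {x : ℕ} {q : Fin 2 → ℕ}
    (h : FCMJ.IsOptimal (divisorInstance x) q) : q 0 = x := by
  obtain ⟨⟨h0, h0'⟩, h1, h1'⟩ := feasible_divisorInstance.1 h.1
  by_contra hne
  have hlt : q 0 + 1 ≤ x := by omega
  have hle := h.2 (![x, q 1] : Fin 2 → ℕ)
    (feasible_divisorInstance.2 ⟨⟨by simp; omega, by simp⟩, h1, h1'⟩)
  change (divisorInstance x).costRate q ≤ (divisorInstance x).costRate ![x, q 1] at hle
  rw [costRate_divisorInstance, costRate_divisorInstance] at hle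
  simp only [Matrix.cons_val_zero, Matrix.cons_val_one] at hle
  have b1 := (one_div_add_sub_lcm_mem h0 h1).1
  have b2 := (one_div_add_sub_lcm_mem (show 1 ≤ x by omega) h1).2
  have hxq : (q 0 : ℚ) + 1 ≤ x := by exact_mod_cast hlt
  have hq : (1 : ℚ) ≤ q 0 := by exact_mod_cast h0
  have hgap : (2 * x ^ 2 : ℚ) / x + 2 < (2 * x ^ 2 : ℚ) / q 0 := by
    have hx : (x : ℚ) ≠ 0 := by linarith
    rw [lt_div_iff₀ (by linarith)]
    have : (2 * x ^ 2 : ℚ) / x = 2 * x := by field_simp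
    rw [this]
    nlinarith
  linarith

/-- For `q 0 = x` and `q 1 = x - r` the objective is, up to terms that do not depend on `r`,
a positive multiple of `(x - gcd x r) / (x - r)`. This is at least `1`, with equality if and only if
`r` divides `x`. The limit `x - 2` excludes the divisor `r = 1`. -/
theorem sub_dvd_of_isOptimal_divisorInstance {x : ℕ} (hx : 2 < x) (hc : ¬ x.Prime) {q : Fin 2 → ℕ}
    (h : FCMJ.IsOptimal (divisorInstance x) q) : x - q 1 ∣ x := by
  have hq0 := eq_of_isOptimal_divisorInstance h
  obtain ⟨-, h1, h1'⟩ := feasible_divisorInstance.1 h.1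
  obtain ⟨r, hr, hr2, hrx⟩ := Nat.exists_dvd_of_not_prime2 (by omega) hc
  have hle := h.2 (![x, x - r] : Fin 2 → ℕ) (feasible_divisorInstance.2
    ⟨⟨by simp; omega, by simp⟩, by simp; omega, by simp; omega⟩)
  change (divisorInstance x).costRate q ≤ (divisorInstance x).costRate ![x, x - r] at hle
  rw [costRate_divisorInstance, costRate_divisorInstance, hq0] at hle
  simp only [Matrix.cons_val_zero, Matrix.cons_val_one] at hle
  have hlcm : ∀ b : ℕ, 1 ≤ b → (1 / b - 1 / (Nat.lcm x b : ℕ) : ℚ) =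
      (x - (Nat.gcd x b : ℕ)) / (x * b) := by
    intro b hb
    have hg : ((Nat.gcd x b : ℕ) : ℚ) * (Nat.lcm x b : ℕ) = x * b := by
      exact_mod_cast Nat.gcd_mul_lcm x b
    have hx0 : (x : ℚ) ≠ 0 := by positivity
    have hb0 : (b : ℚ) ≠ 0 := by positivity
    have hl0 : ((Nat.lcm x b : ℕ) : ℚ) ≠ 0 := by
      exact_mod_cast (Nat.lcm_pos (by omega) (by omega)).ne'
    rw [div_sub_div _ _ hb0 hl0, div_eq_div_iff (by positivity) (by positivity)]
    linear_combination (b : ℚ) * hg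
  have e1 := hlcm (q 1) h1
  have e2 := hlcm (x - r) (by omega)
  have hgr : Nat.gcd x (x - r) = r := by
    rw [Nat.gcd_self_sub_right hrx.le, Nat.gcd_eq_right hr]
  have hle' : ((x : ℚ) - (Nat.gcd x (q 1) : ℕ)) / (x * q 1) ≤
      (x - (r : ℕ)) / (x * (x - r : ℕ)) := by
    rw [hgr] at e2
    linarith
  have hle2 : (x : ℚ) - (Nat.gcd x (q 1) : ℕ) ≤ q 1 := by
    have hxr : ((x - r : ℕ) : ℚ) = x - r := by push_cast [hrx.le]; ring
    have hpos : (0 : ℚ) < x - r := by rw [← hxr]; exact_mod_cast (by omega : 0 < x - r)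
    have hx0 : (0 : ℚ) < x := by positivity
    have hq0 : (0 : ℚ) < q 1 := by exact_mod_cast h1
    rw [hxr, div_le_div_iff₀ (by positivity) (by positivity)] at hle'
    have : ((x : ℚ) * (x - r)) * (x - (Nat.gcd x (q 1) : ℕ)) ≤ (x * (x - r)) * q 1 := by
      linarith
    exact le_of_mul_le_mul_left this (by positivity)
  have hle3 : x ≤ Nat.gcd x (q 1) + q 1 := by
    have : (x : ℚ) ≤ (Nat.gcd x (q 1) : ℕ) + q 1 := by linarith
    exact_mod_cast this
  have hdvd : Nat.gcd x (q 1) ∣ x - q 1 :=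
    Nat.dvd_sub (Nat.gcd_dvd_left _ _) (Nat.gcd_dvd_right _ _)
  have := Nat.le_of_dvd (by omega) hdvd
  have heq : x - q 1 = Nat.gcd x (q 1) := by omega
  rw [heq]
  exact Nat.gcd_dvd_left _ _

end FCMJInstance

open FCMJInstance in
/-- The first entry of the answer of an exact solver on the instance attached to `x` is
irrelevant; the second one has the form `x - r`, where `r` is a nontrivial divisor of `x` if there
is any. -/
theorem OptProblem.SolvedBy.divisorInstance_answer {O : List ℕ → List ℕ}
    (hO : (FCMJ.restrict IsSimple).SolvedBy O) {x : ℕ} (hx : 2 < x) :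
    ∃ q, O (divisorInstance x).encode = [x, q] ∧ 1 ≤ q ∧ q ≤ x - 2 ∧
      (¬ x.Prime → x - q ∣ x) := by
  have hf : (divisorInstance x).Feasible (![x, 1] : Fin 2 → ℕ) :=
    feasible_divisorInstance.2 ⟨⟨by simp; omega, by simp⟩, by simp, by simp; omega⟩
  obtain ⟨q₀, hq₀⟩ := exists_isOptimal hf
  obtain ⟨q, hq, hans⟩ := hO ⟨divisorInstance x, isSimple_divisorInstance x⟩ ⟨q₀, hq₀⟩
  have hq' : FCMJ.IsOptimal (divisorInstance x) q := hq
  obtain ⟨-, h1, h2⟩ := feasible_divisorInstance.1 hq.1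
  refine ⟨q (1 : Fin 2), ?_, h1, h2, fun hc => sub_dvd_of_isOptimal_divisorInstance hx hc hq'⟩
  have hl : ∀ f : Fin 2 → ℕ, List.ofFn f = [f 0, f 1] := fun f => by simp [List.ofFn_succ]
  exact hans.trans ((hl q).trans (by rw [eq_of_isOptimal_divisorInstance hq']))

/-- Every exact solver of a problem is one of its restrictions. -/
theorem OptProblem.IntegerFactorizationHard.of_restrict {Pi : OptProblem} {S : Pi.Inst → Prop}
    (h : (Pi.restrict S).IntegerFactorizationHard) : Pi.IntegerFactorizationHard := by
  obtain ⟨P, p, hP⟩ := h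
  exact ⟨P, p, fun O hO => hP O fun I hI => hO I.1 hI⟩

/-! ### Straight-line programs -/

namespace Prog

/-- The straight-line program with the instructions `a :: l`. -/
def straight : Instr → List Instr → Prog
  | a, [] => instr a
  | a, b :: l => seq (instr a) (straight b l)

/-- Effect of a sequence of instructions. -/
def exec (O : List ℕ → List ℕ) : List Instr → MachineState → MachineState
  | [], s => s
  | a :: l, s => exec O l (a.apply O s)

/-- Cost of a sequence of instructions. -/
def execCost (O : List ℕ → List ℕ) : List Instr → MachineState → ℕ
  | [], _ => 0
  | a :: l, s => a.cost s + execCost O l (a.apply O s)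

theorem runs_straight (O : List ℕ → List ℕ) (a : Instr) (l : List Instr) (s : MachineState) :
    Runs O (straight a l) s (execCost O (a :: l) s) (exec O (a :: l) s) := by
  induction l generalizing a s with
  | nil => exact Runs.instr a s
  | cons b l ih => exact Runs.seq (Runs.instr a s) (ih b _)

end Prog

/-! ### The factorization program -/

namespace Factorization

open Instr Prog

/-- Oracle query for a number `x > 2` in register `1`, where registers `3`, `4`, `5` and `6` hold
`0`, `1`, `2` and `x - 2`. If the answer is `[_, q]`, then register `8` becomes `r = x - q`, and
register `9` becomes the remainder of `x` modulo `r`. -/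
def query : Prog :=
  straight (mul 7 1 1) [add 7 7 7, ask 4, ask 5, ask 3, ask 4, ask 4, ask 3, ask 3, ask 7, ask 3,
    ask 4, ask 4, ask 1, ask 6, call, receive 8, receive 8, sub 8 1 8, div 9 1 8, mul 9 9 8,
    sub 9 1 9]

/-- One round on the numbers `N` in register `0` and `x` in register `1`. If the oracle finds a
nontrivial divisor of `x`, then `x` is replaced by this divisor. Otherwise `x` is prime: it is
written on the output tape, `N` is divided by it, and `x` is reset to the new value of `N`.
Register `2` receives `N - 1`. No oracle is asked for `x = 2`, since the instance attached to `2` is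
infeasible and the answer could be arbitrarily long. -/
def round : Prog :=
  seq (straight (const 3 0) [const 4 1, const 5 2, sub 6 1 5])
    (seq (Prog.cond 6 query (instr (const 9 1)))
      (Prog.cond 9 (straight (write 1) [div 0 0 1, copy 1 0, sub 2 0 4])
        (straight (copy 1 8) [sub 2 0 4])))

/-- The factorization program: it repeats the rounds until the cofactor in register `0` is `1`. -/
def program : Prog :=
  seq (straight (copy 1 0) [const 4 1, sub 2 0 4]) (loop 2 round)

end Factorization

/-! ### Bit lengths -/

theorem Nat.size_lt_size_of_two_mul_le {m n : ℕ} (hm : 0 < m) (h : 2 * m ≤ n) :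
    m.size < n.size := by
  rw [Nat.lt_size]
  have h1 : m.size - 1 < m.size := Nat.sub_lt (Nat.size_pos.2 hm) one_pos
  rw [Nat.lt_size] at h1
  have h2 : 2 ^ m.size = 2 * 2 ^ (m.size - 1) := by
    rw [← pow_succ']
    congr 1
    have := Nat.size_pos.2 hm
    omega
  omega

theorem Nat.size_le_of_le_two_mul_sq {a M : ℕ} (hM : 1 < M) (h : a ≤ M * M + M * M) :
    a.size ≤ 3 * M.size := by
  rw [Nat.size_le]
  have h1 : M < 2 ^ M.size := Nat.lt_size_self M
  have h2 : 2 ≤ 2 ^ M.size := by omega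
  have h3 : 2 ^ (3 * M.size) = 2 ^ M.size * (2 ^ M.size * 2 ^ M.size) := by ring
  rw [h3]
  nlinarith [Nat.mul_lt_mul'' h1 h1]

/-! ### Correctness and cost of the program -/

namespace Factorization

open Instr Prog

theorem runs_query {O : List ℕ → List ℕ} {s : MachineState} {M x q : ℕ} (hM : 1 < M) (hx : 2 < x)
    (hxM : x ≤ M) (hO : O (FCMJInstance.divisorInstance x).encode = [x, q]) (hq : q ≤ x)
    (h1 : s.mem 1 = x) (h3 : s.mem 3 = 0) (h4 : s.mem 4 = 1) (h5 : s.mem 5 = 2)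
    (h6 : s.mem 6 = x - 2) (hs : s.query = []) :
    ∃ t s', Runs O query s t s' ∧ t ≤ 200 * M.size ∧ s'.mem 0 = s.mem 0 ∧ s'.mem 1 = x ∧
      s'.mem 4 = 1 ∧ s'.mem 8 = x - q ∧ s'.mem 9 = x % (x - q) ∧ s'.query = [] ∧
      s'.out = s.out := by
  have hO' : O [1, 2, 0, 1, 1, 0, 0, x * x + x * x, 0, 1, 1, x, x - 2] = [x, q] := by
    rw [← FCMJInstance.encode_divisorInstance, hO]
  have hxx : x * x ≤ M * M := Nat.mul_le_mul hxM hxM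
  have hMM : M ≤ M * M := Nat.le_mul_self M
  have hd : x / (x - q) * (x - q) ≤ x := Nat.div_mul_le_self _ _
  have hd' : x / (x - q) ≤ x := Nat.div_le_self _ _
  have b1 : x.size ≤ 3 * M.size := Nat.size_le_of_le_two_mul_sq hM (by omega)
  have b2 : (x - 2).size ≤ 3 * M.size := Nat.size_le_of_le_two_mul_sq hM (by omega)
  have b3 : (x * x).size ≤ 3 * M.size := Nat.size_le_of_le_two_mul_sq hM (by omega)
  have b4 : (x * x + x * x).size ≤ 3 * M.size := Nat.size_le_of_le_two_mul_sq hM (by omega)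
  have b5 : q.size ≤ 3 * M.size := Nat.size_le_of_le_two_mul_sq hM (by omega)
  have b6 : (x - q).size ≤ 3 * M.size := Nat.size_le_of_le_two_mul_sq hM (by omega)
  have b7 : (x / (x - q)).size ≤ 3 * M.size := Nat.size_le_of_le_two_mul_sq hM (by omega)
  have b8 : (x / (x - q) * (x - q)).size ≤ 3 * M.size :=
    Nat.size_le_of_le_two_mul_sq hM (by omega)
  have b9 : (2 : ℕ).size ≤ M.size := Nat.size_le_size hM
  have b10 : (2 : ℕ).size = 2 := by decide
  refine ⟨_, _, runs_straight O _ _ s, ?_, ?_⟩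
  · simp [execCost, Instr.cost, Instr.apply, MachineState.set, h1, h3, h4,
      h5, h6, hs, hO']
    linarith
  · have hm : x - x / (x - q) * (x - q) = x % (x - q) := by rw [mul_comm, Nat.mod_eq_sub]
    simp only [exec, Instr.apply, MachineState.set]
    simp [h1, h3, h4, h5, h6, hs, hO', hm]

/-- The effect of one round on the pair `(N, x)`. -/
theorem runs_round {O : List ℕ → List ℕ} (hO : (FCMJ.restrict FCMJInstance.IsSimple).SolvedBy O)
    {s : MachineState} {M N x : ℕ} (hM : 1 < M) (hNM : N ≤ M) (hx : 1 < x) (hxN : x ≤ N)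
    (h0 : s.mem 0 = N) (h1 : s.mem 1 = x) (hs : s.query = []) :
    ∃ t s', Runs O round s t s' ∧ t ≤ 300 * M.size ∧ s'.mem 2 = s'.mem 0 - 1 ∧ s'.query = [] ∧
      ((s'.mem 0 = N ∧ s'.mem 1 ∣ x ∧ 1 < s'.mem 1 ∧ s'.mem 1 < x ∧ s'.out = s.out) ∨
        (x.Prime ∧ s'.mem 0 = N / x ∧ s'.mem 1 = N / x ∧ s'.out = s.out ++ [x])) := by
  have hMM : M ≤ M * M := Nat.le_mul_self M
  have bM : ∀ a, a ≤ M → a.size ≤ 3 * M.size := fun a ha =>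
    Nat.size_le_of_le_two_mul_sq hM (by omega)
  have b0 := bM N hNM
  have b1 := bM x (by omega)
  have b2 := bM (x - 2) (by omega)
  have b3 := bM (N / x) ((Nat.div_le_self _ _).trans hNM)
  have b9 : (2 : ℕ).size ≤ M.size := Nat.size_le_size hM
  have b10 : (2 : ℕ).size = 2 := by decide
  -- the first two parts of the round: register `9` becomes zero exactly if a divisor was found
  have key : ∃ t s', Runs O (seq (straight (const 3 0) [const 4 1, const 5 2, sub 6 1 5])
      (Prog.cond 6 query (instr (const 9 1)))) s t s' ∧ t ≤ 240 * M.size ∧ s'.mem 0 = N ∧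
      s'.mem 1 = x ∧ s'.mem 4 = 1 ∧ s'.query = [] ∧ s'.out = s.out ∧ s'.mem 9 ≤ M ∧
      (s'.mem 9 ≠ 0 → x.Prime) ∧
      (s'.mem 9 = 0 → s'.mem 8 ∣ x ∧ 1 < s'.mem 8 ∧ s'.mem 8 < x) := by
    have r1 := runs_straight O (const 3 0) [const 4 1, const 5 2, sub 6 1 5] s
    set s₁ := exec O [const 3 0, const 4 1, const 5 2, sub 6 1 5] s with hs₁
    have c1 : execCost O [const 3 0, const 4 1, const 5 2, sub 6 1 5] s ≤ 10 * M.size := by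
      simp [execCost, Instr.cost, Instr.apply, MachineState.set, h1]
      omega
    have m0 : s₁.mem 0 = N := by
      simp [hs₁, exec, Instr.apply, MachineState.set, h0]
    have m1 : s₁.mem 1 = x := by
      simp [hs₁, exec, Instr.apply, MachineState.set, h1]
    have m3 : s₁.mem 3 = 0 := by
      simp [hs₁, exec, Instr.apply, MachineState.set]
    have m4 : s₁.mem 4 = 1 := by
      simp [hs₁, exec, Instr.apply, MachineState.set]
    have m5 : s₁.mem 5 = 2 := by
      simp [hs₁, exec, Instr.apply, MachineState.set]
    have m6 : s₁.mem 6 = x - 2 := by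
      simp [hs₁, exec, Instr.apply, MachineState.set, h1]
    have mq : s₁.query = [] := by simp [hs₁, exec, Instr.apply, MachineState.set, hs]
    have mo : s₁.out = s.out := by simp [hs₁, exec, Instr.apply, MachineState.set]
    rcases (show x = 2 ∨ 2 < x by omega) with rfl | hx2
    · refine ⟨_, _, Runs.seq r1 (Runs.cond_zero (by simp [m6]) (Runs.instr _ _)), ?_, ?_⟩
      · simp [Instr.cost, m6]
        omega
      · simp [Instr.apply, MachineState.set, m0, m1, m4, mq, mo,
          Nat.prime_two]
        omega
    · obtain ⟨q, hans, hq1, hq2, hqd⟩ := hO.divisorInstance_answer hx2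
      obtain ⟨t, s', hr, ht, e0, e1, e4, e8, e9, eq, eo⟩ :=
        runs_query hM hx2 (hxN.trans hNM) hans (by omega) m1 m3 m4 m5 m6 mq
      refine ⟨_, s', Runs.seq r1 (Runs.cond_pos (by rw [m6]; omega) hr), ?_, e0.trans m0, e1, e4,
        eq, eo.trans mo, ?_, ?_, ?_⟩
      · rw [m6]
        omega
      · rw [e9]
        exact (Nat.mod_le _ _).trans (hxN.trans hNM)
      · intro h
        by_contra hp
        exact h (by rw [e9, Nat.mod_eq_zero_of_dvd (hqd hp)])
      · intro h
        rw [e9] at h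
        rw [e8]
        exact ⟨Nat.dvd_of_mod_eq_zero h, by omega, by omega⟩
  obtain ⟨t, s₂, hr, ht, e0, e1, e4, eq, eo, e9, hp, hd⟩ := key
  have b4 := bM _ e9
  cases hr with
  | seq r1 r2 =>
  by_cases h9 : s₂.mem 9 = 0
  · obtain ⟨hd1, hd2, hd3⟩ := hd h9
    have b5 := bM (s₂.mem 8) (by omega)
    refine ⟨_, _, Runs.seq r1 (Runs.seq r2 (Runs.cond_zero h9 (runs_straight O _ _ _))), ?_, ?_⟩
    · simp [execCost, Instr.cost, Instr.apply, MachineState.set, e0, e4]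
      omega
    · simp [exec, Instr.apply, MachineState.set, e0, e4, eq, eo, hd1, hd2,
        hd3]
  · refine ⟨_, _, Runs.seq r1 (Runs.seq r2 (Runs.cond_pos h9 (runs_straight O _ _ _))), ?_, ?_⟩
    · simp [execCost, Instr.cost, Instr.apply, MachineState.set, e0, e1, e4]
      omega
    · simp [exec, Instr.apply, MachineState.set, e0, e1, e4, eq, eo, hp h9]

/-- Correctness and cost of the main loop. The invariant is that the numbers written so far are
primes with product `M / N`, and that `x` is a divisor of `N` other than `1` unless `N = 1`. In each
round either `x` is at least halved, or `N` is at least halved while `x` grows to at most `M`;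
hence the potential `N.size * (M.size + 1) + x.size` decreases. -/
theorem runs_loop_round {O : List ℕ → List ℕ}
    (hO : (FCMJ.restrict FCMJInstance.IsSimple).SolvedBy O) {M : ℕ} (hM : 1 < M) (k : ℕ) :
    ∀ s : MachineState, s.mem 2 = s.mem 0 - 1 → s.query = [] → (∀ r ∈ s.out, r.Prime) →
      s.out.prod * s.mem 0 = M → s.mem 1 ∣ s.mem 0 → (1 < s.mem 0 → 1 < s.mem 1) →
      (s.mem 0).size * (M.size + 1) + (s.mem 1).size ≤ k →
      ∃ t s', Runs O (loop 2 round) s t s' ∧ t ≤ (k + 1) * (304 * M.size) ∧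
        (∀ r ∈ s'.out, r.Prime) ∧ s'.out.prod = M := by
  have hM2 : (2 : ℕ).size ≤ M.size := Nat.size_le_size hM
  rw [show (2 : ℕ).size = 2 by decide] at hM2
  induction k using Nat.strong_induction_on with
  | _ k ih =>
  intro s h2 hs hp hprod hdvd hx hk
  have hN0 : s.mem 0 ≠ 0 := by
    rintro h
    rw [h] at hprod
    omega
  have hNM : s.mem 0 ≤ M := Nat.le_of_dvd (by omega) ⟨s.out.prod, by rw [← hprod, mul_comm]⟩
  have hsz : (s.mem 2).size ≤ M.size := Nat.size_le_size (by omega)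
  by_cases hN : s.mem 0 = 1
  · refine ⟨_, s, Runs.loop_done (by omega), ?_, hp, by rw [← hprod, hN, mul_one]⟩
    nlinarith
  · have hx1 := hx (by omega)
    have hxN := Nat.le_of_dvd (by omega) hdvd
    obtain ⟨t₁, s₁, hr, ht, e2, eq, hcase⟩ := runs_round hO hM hNM hx1 hxN rfl rfl hs
    have hrec : ∃ j < k, ∃ t s', Runs O (loop 2 round) s₁ t s' ∧ t ≤ (j + 1) * (304 * M.size) ∧
        (∀ r ∈ s'.out, r.Prime) ∧ s'.out.prod = M := by
      rcases hcase with ⟨e0, e1, e1', e1'', eo⟩ | ⟨hpr, e0, e1, eo⟩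
      · refine ⟨_, ?_, ih ((s₁.mem 0).size * (M.size + 1) + (s₁.mem 1).size) ?_ s₁ e2 eq
          (by rwa [eo]) (by rw [eo, e0, hprod]) (by rw [e0]; exact e1.trans hdvd)
          (fun _ => e1') le_rfl⟩ <;>
        · have : (s₁.mem 1).size < (s.mem 1).size := by
            apply Nat.size_lt_size_of_two_mul_le (by omega)
            obtain ⟨c, hc⟩ := e1
            have hc2 : 2 ≤ c := by
              by_contra hlt
              have : c = 0 ∨ c = 1 := by omega
              rcases this with rfl | rfl <;> omega
            rw [hc, mul_comm]
            exact Nat.mul_le_mul_left _ hc2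
          rw [e0]
          omega
      · have hm : s.mem 1 * (s.mem 0 / s.mem 1) = s.mem 0 := Nat.mul_div_cancel' hdvd
        have hpos : 0 < s.mem 0 / s.mem 1 := Nat.div_pos hxN (by omega)
        have hlt : (s.mem 0 / s.mem 1).size < (s.mem 0).size := by
          apply Nat.size_lt_size_of_two_mul_le hpos
          calc 2 * (s.mem 0 / s.mem 1) ≤ s.mem 1 * (s.mem 0 / s.mem 1) :=
                Nat.mul_le_mul_right _ hx1
            _ = s.mem 0 := hm
        have hle : (s.mem 0 / s.mem 1).size ≤ M.size :=
          Nat.size_le_size ((Nat.div_le_self _ _).trans hNM)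
        refine ⟨_, ?_, ih ((s₁.mem 0).size * (M.size + 1) + (s₁.mem 1).size) ?_ s₁ e2 eq
          ?_ ?_ (by rw [e0, e1]) (by rw [e0, e1]; exact id) le_rfl⟩
        rotate_left 2
        · rw [eo]
          intro r hr
          rcases List.mem_append.1 hr with hr | hr
          · exact hp r hr
          · rw [List.mem_singleton.1 hr]
            exact hpr
        · rw [eo, e0, List.prod_append, List.prod_singleton, mul_assoc, hm, hprod]
        all_goals
          rw [e0, e1]
          nlinarith
    obtain ⟨j, hj, t, s', hr', ht', hout⟩ := hrec
    refine ⟨_, s', Runs.loop_step (by omega) hr hr', ?_, hout⟩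
    have : (j + 1) * (304 * M.size) + 304 * M.size ≤ (k + 1) * (304 * M.size) := by
      rw [← Nat.succ_mul]
      exact Nat.mul_le_mul_right _ (by omega)
    omega

theorem runs_program {O : List ℕ → List ℕ}
    (hO : (FCMJ.restrict FCMJInstance.IsSimple).SolvedBy O) {M : ℕ} (hM : 1 < M) :
    ∃ t s, Runs O program (MachineState.init M) t s ∧ t ≤ 2000 * M.size ^ 3 ∧
      (∀ r ∈ s.out, r.Prime) ∧ s.out.prod = M := by
  have hM2 : (2 : ℕ).size ≤ M.size := Nat.size_le_size hM
  rw [show (2 : ℕ).size = 2 by decide] at hM2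
  have r1 := runs_straight O (copy 1 0) [const 4 1, sub 2 0 4] (MachineState.init M)
  set s₁ := exec O [copy 1 0, const 4 1, sub 2 0 4] (MachineState.init M) with hs₁
  have c1 : execCost O [copy 1 0, const 4 1, sub 2 0 4] (MachineState.init M) ≤ 5 * M.size := by
    simp [execCost, Instr.cost, Instr.apply, MachineState.set, MachineState.init]
    omega
  have m0 : s₁.mem 0 = M := by
    simp [hs₁, exec, Instr.apply, MachineState.set, MachineState.init]
  have m1 : s₁.mem 1 = M := by
    simp [hs₁, exec, Instr.apply, MachineState.set, MachineState.init]
  have m2 : s₁.mem 2 = M - 1 := by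
    simp [hs₁, exec, Instr.apply, MachineState.set, MachineState.init]
  have mq : s₁.query = [] := by
    simp [hs₁, exec, Instr.apply, MachineState.set, MachineState.init]
  have mo : s₁.out = [] := by
    simp [hs₁, exec, Instr.apply, MachineState.set, MachineState.init]
  obtain ⟨t, s, hr, ht, hout⟩ := runs_loop_round hO hM _ s₁ (by rw [m0, m2]) mq (by simp [mo])
    (by simp [mo, m0]) (by rw [m0, m1]) (by rw [m0, m1]; exact id) le_rfl
  refine ⟨_, s, Runs.seq r1 hr, ?_, hout⟩
  rw [m0, m1] at ht
  generalize M.size = n at *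
  nlinarith [Nat.mul_le_mul_left (n ^ 2) hM2, Nat.mul_le_mul_left n hM2]

end Factorization

theorem theorem2 :
    FCMJ.IntegerFactorizationHard ∧
      (FCMJ.restrict FCMJInstance.IsSimple).IntegerFactorizationHard := by
  have h : (FCMJ.restrict FCMJInstance.IsSimple).IntegerFactorizationHard := by
    refine ⟨Factorization.program, 2000 * Polynomial.X ^ 3, fun O hO M hM _ => ?_⟩
    obtain ⟨t, s, hr, ht, hout⟩ := Factorization.runs_program hO hM
    exact ⟨t, s, hr, by simpa using ht, hout⟩
  exact ⟨h.of_restrict, h⟩
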